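/- Let $G$ be a profinite group and let $A$ be a commutative ring. Let $\mathcal F(G)$ be the set of isomorphism classes of finite transitive discrete $G$-sets. For $T,U\in\mathcal F(G)$ write $U\le T$ if there is a $G$-map $T\to U$, and let $\varphi_T(U)$ be the number of $G$-maps $T\to U$. The Witt polynomial of $T$ is $$W_T(\underline X)=\sum_{U\le T}\varphi_T(U)\,X_U^{\#T/\#U}\in\mathbf Z[\{X_U\}_{U\in\mathcal F(G)}].$$ There are unique families of polynomials $S_T,M_T\in\mathbf Z[\underline X,\underline Y]$ with $W_T(\underline S)=W_T(\underline X)+W_T(\underline Y)$ and $W_T(\underline M)=W_T(\underline X)W_T(\underline Y)$ for all $T\in\mathcal F(G)$. The Witt--Burnside ring $\mathbf W_G(A)$ is the set $\prod_{T\in\mathcal F(G)}A$ with the ring operations $\mathbf a+\mathbf b=(S_T(\mathbf a,\mathbf b))_T$ and $\mathbf a\cdot\mathbf b=(M_T(\mathbf a,\mathbf b))_T$. For an open normal subgroup $N$ of $G$, let $$K_N=\{\mathbf a\in\mathbf W_G(A): a_T=0\text{ for every }T\in\mathcal F(G)\text{ on which }N\text{ acts trivially}\}$$ (the kernel of the projection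 $\mathbf W_G(A)\to\mathbf W_{G/N}(A)$), and for an integer $n\ge 1$ let $$I_n=\{\mathbf a\in\mathbf W_G(A): a_T=0\text{ for every }T\in\mathcal F(G)\text{ with }\#T<n\}.$$ These are ideals of $\mathbf W_G(A)$. The profinite topology on $\mathbf W_G(A)$ is the topology induced by the natural map $\mathbf W_G(A)\to\prod_N\mathbf W_G(A)/K_N$, where $N$ runs over the open normal subgroups of $G$ and each factor is discrete. The initial vanishing topology on $\mathbf W_G(A)$ is the topology in which a subset $\mathcal O$ is open if and only if for every $\mathbf a\in\mathcal O$ there is an $n\ge 1$ with $\mathbf a+I_n\subseteq\mathcal O$. Theorem. 1. For every open normal subgroup $N$ of $G$, the ideal $K_N$ is open in the initial vanishing topology on $\mathbf W_G(A)$. 2. If $G$ is topologically finitely generated (some finite subset of $G$ generates a dense subgroup), then the profinite topology and the initial vanishing topology on $\mathbf W_G(A)$ are the same. -/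

import Mathlib

set_option linter.unusedSectionVars false

namespace WittBurnside

section Divisibility

theorem orbit_dvd {R Q Z : Type*} [CommRing R] [Group Q] [Fintype Q] [Fintype Z] [DecidableEq Z]
    [MulAction Q Z] [∀ z : Z, Fintype (MulAction.stabilizer Q z)]
    (F : Q → Z → R) (hF : ∀ g q z, F (g * q * g⁻¹) (g • z) = F q z)
    (hd : ∀ z : Z, (Nat.card (MulAction.stabilizer Q z) : R) ∣
      ∑ q : MulAction.stabilizer Q z, F q z) :
    (Nat.card Q : R) ∣ ∑ q : Q, ∑ z : Z with q • z = z, F q z := by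
  classical
  have hJ : ∀ z : Z, ∑ q : Q with q • z = z, F q z = ∑ q : MulAction.stabilizer Q z, F q z := by
    intro z
    rw [← Finset.sum_subtype_eq_sum_filter]
    refine Finset.sum_bij' (fun q _ => ⟨q.1, ?_⟩) (fun q _ => ⟨q.1, ?_⟩) ?_ ?_ ?_ ?_ ?_
    · exact q.2
    · exact q.2
    all_goals simp
  have hinv : ∀ (g : Q) (z : Z), ∑ q : Q with q • (g • z) = g • z, F q (g • z)
      = ∑ q : Q with q • z = z, F q z := by
    intro g z
    rw [Finset.sum_filter, Finset.sum_filter]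
    refine (Fintype.sum_equiv (MulAut.conj g).toEquiv _ _ fun q => ?_).symm
    simp [hF, mul_smul]
  have hswap : ∑ q : Q, ∑ z : Z with q • z = z, F q z
      = ∑ z : Z, ∑ q : Q with q • z = z, F q z := by
    simp_rw [Finset.sum_filter]
    exact Finset.sum_comm
  rw [hswap, ← Finset.sum_fiberwise (s := Finset.univ)
    (g := fun z : Z => (Quotient.mk (MulAction.orbitRel Q Z) z))]
  refine Finset.dvd_sum fun o _ => ?_
  induction o using Quotient.inductionOn with
  | h z₀ =>
  have h1 : ∀ z ∈ Finset.univ.filter (fun z : Z =>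
      Quotient.mk (MulAction.orbitRel Q Z) z = Quotient.mk _ z₀),
      ∑ q : Q with q • z = z, F q z = ∑ q : Q with q • z₀ = z₀, F q z₀ := by
    intro z hz
    have hz2 : z ∈ MulAction.orbit Q z₀ := MulAction.orbitRel_apply.1
      (Quotient.exact (Finset.mem_filter.1 hz).2)
    obtain ⟨g, rfl⟩ := hz2
    exact hinv g z₀
  rw [Finset.sum_congr rfl h1, Finset.sum_const, hJ]
  obtain ⟨c, hc⟩ := hd z₀
  have hcard : (Finset.univ.filter (fun z : Z =>
      Quotient.mk (MulAction.orbitRel Q Z) z = Quotient.mk _ z₀)).card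
      * Nat.card (MulAction.stabilizer Q z₀) = Nat.card Q := by
    have := MulAction.card_orbit_mul_card_stabilizer_eq_card_group Q z₀
    rw [Nat.card_eq_fintype_card, Nat.card_eq_fintype_card, ← this]
    congr 1
    rw [Fintype.card_subtype]
    congr 1
    ext z
    simp only [Finset.mem_filter, Finset.mem_univ, true_and]
    rw [← MulAction.orbitRel_apply]
    exact Quotient.eq
  rw [hc, nsmul_eq_mul, ← mul_assoc, ← Nat.cast_mul, hcard]
  exact dvd_mul_right _ _

/-- Modulo `n`, an integral polynomial is a finite sum of monic monomials. -/
theorem exists_monomials {σ : Type*} (n : ℕ) (hn : 0 < n) (s : MvPolynomial σ ℤ) :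
    ∃ (k : ℕ) (m : Fin k → MvPolynomial σ ℤ),
      (∀ d i, MvPolynomial.expand d (m i) = m i ^ d) ∧ (n : MvPolynomial σ ℤ) ∣ s - ∑ i, m i := by
  induction s using MvPolynomial.induction_on with
  | C a =>
    refine ⟨(a % n).toNat, fun _ => 1, fun d i => by simp, ?_⟩
    have h1 : ((a % n).toNat : ℤ) = a % n :=
      Int.toNat_of_nonneg (Int.emod_nonneg _ (by positivity))
    have h2 : (∑ _i : Fin (a % n).toNat, (1 : MvPolynomial σ ℤ))
        = MvPolynomial.C (((a % n).toNat : ℤ)) := by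
      rw [Finset.sum_const, Finset.card_univ, Fintype.card_fin, nsmul_one]
      exact (map_natCast _ _).symm
    have h3 : (n : MvPolynomial σ ℤ) = MvPolynomial.C (n : ℤ) := by simp
    rw [h2, h1, h3, ← MvPolynomial.C_sub]
    exact map_dvd _ (Int.dvd_self_sub_emod)
  | add p q hp hq =>
    obtain ⟨k, m, hm, h⟩ := hp
    obtain ⟨l, m', hm', h'⟩ := hq
    refine ⟨k + l, Fin.append m m', ?_, ?_⟩
    · intro d i
      refine Fin.addCases (fun i => ?_) (fun i => ?_) i
      · simpa using hm d i
      · simpa using hm' d i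
    · rw [Fin.sum_univ_add]
      simp only [Fin.append_left, Fin.append_right]
      have := dvd_add h h'
      convert this using 1
      ring
  | mul_X p j hp =>
    obtain ⟨k, m, hm, h⟩ := hp
    refine ⟨k, fun i => m i * MvPolynomial.X j, ?_, ?_⟩
    · intro d i
      simp [hm, mul_pow]
    · rw [← Finset.sum_mul, ← sub_mul]
      exact h.mul_right _

open Classical in
theorem cyclic_dvd {σ Q : Type*} [Group Q] [Fintype Q] (s : MvPolynomial σ ℤ) :
    (Nat.card Q : MvPolynomial σ ℤ) ∣
      ∑ q : Q, MvPolynomial.expand (orderOf q) s ^ (Nat.card Q / orderOf q) := by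
  obtain ⟨k, m, hm, hs⟩ := exists_monomials (Nat.card Q) Nat.card_pos s
  have hred : (Nat.card Q : MvPolynomial σ ℤ) ∣
      (∑ q : Q, MvPolynomial.expand (orderOf q) s ^ (Nat.card Q / orderOf q)) -
      ∑ q : Q, MvPolynomial.expand (orderOf q) (∑ i, m i) ^ (Nat.card Q / orderOf q) := by
    rw [← Finset.sum_sub_distrib]
    refine Finset.dvd_sum fun q _ => ?_
    refine dvd_trans ?_ (sub_dvd_pow_sub_pow _ _ _)
    rw [← map_sub]
    simpa using map_dvd (MvPolynomial.expand (orderOf q)) hs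
  refine (dvd_iff_dvd_of_dvd_sub hred).2 ?_
  let act : MulAction Q (Q → Fin k) :=
    { smul := fun q c x => c (x * q)
      one_smul := fun c => funext fun x => congrArg c (mul_one x)
      mul_smul := fun q r c => funext fun x => congrArg c (mul_assoc x q r).symm }
  have smul_def : ∀ (q : Q) (c : Q → Fin k) (x : Q), (q • c) x = c (x * q) := fun _ _ _ => rfl
  have hmain := orbit_dvd (R := MvPolynomial σ ℤ) (Q := Q) (Z := Q → Fin k)
    (fun _ c => ∏ x, m (c x))
    (fun g _ c => Fintype.prod_equiv (Equiv.mulRight g) _ _ fun x => rfl)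
    (fun z => by
      rw [Finset.sum_const, nsmul_eq_mul, Finset.card_univ, ← Nat.card_eq_fintype_card]
      exact dvd_mul_right _ _)
  convert hmain using 1
  refine Finset.sum_congr rfl fun q _ => ?_
  have hcardq : Nat.card Q / orderOf q = Fintype.card (Q ⧸ Subgroup.zpowers q) := by
    have h := Subgroup.card_eq_card_quotient_mul_card_subgroup (Subgroup.zpowers q)
    rw [Nat.card_zpowers] at h
    rw [h, Nat.mul_div_cancel _ (orderOf_pos q), Nat.card_eq_fintype_card]
  rw [map_sum, hcardq, ← Finset.card_univ, ← Finset.prod_const, Finset.prod_univ_sum]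
  simp only [hm]
  have hconst : ∀ c : Q → Fin k, q • c = c → ∀ x y : Q,
      (x : Q ⧸ Subgroup.zpowers q) = y → c x = c y := by
    intro c hc x y hxy
    have hz : ∀ z ∈ Subgroup.zpowers q, z • c = c := by
      intro z hz
      have : Subgroup.zpowers q ≤ MulAction.stabilizer Q c := by
        rw [Subgroup.zpowers_le]; exact hc
      exact this hz
    have h1 := congrFun (hz _ (QuotientGroup.eq.1 hxy)) x
    rw [smul_def] at h1
    rw [← h1, mul_inv_cancel_left]
  refine Finset.sum_bij' (fun b _ => fun x : Q => b (x : Q ⧸ Subgroup.zpowers q))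
    (fun c _ => fun o => c o.out) ?_ ?_ ?_ ?_ ?_
  · intro b _
    simp only [Finset.mem_filter, Finset.mem_univ, true_and]
    funext x
    rw [smul_def]
    congr 1
    exact QuotientGroup.eq.2 (by simp)
  · intro c _
    simp
  · intro b _
    funext o
    simp
  · intro c hc
    funext x
    exact hconst c (Finset.mem_filter.1 hc).2 _ _ (by simp)
  · intro b _
    rw [Fintype.prod_equiv (Subgroup.groupEquivQuotientProdSubgroup (s := Subgroup.zpowers q))
      (fun x => m (b (x : Q ⧸ Subgroup.zpowers q))) (fun y => m (b y.1)) (fun x => rfl),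
      Fintype.prod_prod_type]
    refine Finset.prod_congr rfl fun o _ => ?_
    simp only [Finset.prod_const, Finset.card_univ, Fintype.card_zpowers]

open Classical in
theorem action_dvd {σ Q Z : Type*} [Group Q] [Fintype Q] [Fintype Z] [MulAction Q Z]
    (r r' : MvPolynomial σ ℤ) (e e' : ℕ)
    (he : ∀ z : Z, Nat.card (MulAction.stabilizer Q z) ∣ e)
    (he' : ∀ z : Z, Nat.card (MulAction.stabilizer Q z) ∣ e') :
    (Nat.card Q : MvPolynomial σ ℤ) ∣ ∑ q : Q, (Nat.card {z : Z // q • z = z} : MvPolynomial σ ℤ) *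
      MvPolynomial.expand (orderOf q) (r ^ (e / orderOf q) * r' ^ (e' / orderOf q)) := by
  have hmain := orbit_dvd (R := MvPolynomial σ ℤ) (Q := Q) (Z := Z)
    (fun q _ => MvPolynomial.expand (orderOf q) (r ^ (e / orderOf q) * r' ^ (e' / orderOf q)))
    (fun g q z => by
      have : orderOf (g * q * g⁻¹) = orderOf q := by
        have := orderOf_injective (MulAut.conj g).toMonoidHom (MulAut.conj g).injective q
        simpa using this
      simp only [this])
    (fun z => by
      obtain ⟨a, ha⟩ := he z
      obtain ⟨b, hb⟩ := he' z
      refine (cyclic_dvd (Q := MulAction.stabilizer Q z) (r ^ a * r' ^ b)).trans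
        (dvd_of_eq (Finset.sum_congr rfl fun q _ => ?_))
      have hq : orderOf (q : Q) = orderOf q := Subgroup.orderOf_coe q
      obtain ⟨t, ht⟩ := orderOf_dvd_natCard q
      rw [hq, ← map_pow, ha, hb, mul_pow, ← pow_mul, ← pow_mul, ht,
        Nat.mul_div_cancel_left _ (orderOf_pos q), mul_assoc, mul_assoc,
        Nat.mul_div_cancel_left _ (orderOf_pos q), Nat.mul_div_cancel_left _ (orderOf_pos q),
        mul_comm a, mul_comm b])
  convert hmain using 1
  refine Finset.sum_congr rfl fun q _ => ?_
  rw [Finset.sum_const, nsmul_eq_mul, Nat.card_eq_fintype_card, Fintype.card_subtype]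

end Divisibility
section FrameDefs

/-- Two open subgroups `H`, `K` of `G` are related when the transitive `G`-sets `G ⧸ H` and
`G ⧸ K` are isomorphic. -/
def frameSetoid (G : Type*) [Group G] [TopologicalSpace G] : Setoid (OpenSubgroup G) where
  r H K := ∃ f : (G ⧸ H.toSubgroup) →[G] (G ⧸ K.toSubgroup), Function.Bijective f
  iseqv :=
    { refl := fun _ => ⟨MulActionHom.id G, Function.bijective_id⟩
      symm := fun {_ _} ⟨f, hf⟩ => by
        obtain ⟨g, hl, hr⟩ := Function.bijective_iff_has_inverse.1 hf
        exact ⟨f.inverse g hl hr, Function.bijective_iff_has_inverse.2 ⟨f, hr, hl⟩⟩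
      trans := fun {_ _ _} ⟨f, hf⟩ ⟨g, hg⟩ => ⟨g.comp f, hg.comp hf⟩ }

/-- The frame of a profinite group `G`: the isomorphism classes of finite transitive discrete
`G`-sets. Every such `G`-set is isomorphic to `G ⧸ H` for an open subgroup `H`. -/
def Frame (G : Type*) [Group G] [TopologicalSpace G] : Type _ := Quotient (frameSetoid G)

namespace Frame

variable {G : Type*} [Group G] [TopologicalSpace G]

/-- The class of `G ⧸ H`. -/
def mk (H : OpenSubgroup G) : Frame G := Quotient.mk (frameSetoid G) H

/-- An open subgroup `H` such that `G ⧸ H` belongs to the class `T`. -/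
noncomputable def rep (T : Frame G) : OpenSubgroup G := Quotient.out T

/-- A transitive `G`-set in the class `T`. -/
abbrev Carrier (T : Frame G) : Type _ := G ⧸ T.rep.toSubgroup

/-- The number of elements of `T`. -/
noncomputable def size (T : Frame G) : ℕ := Nat.card T.Carrier

/-- `phi T U` is the number of `G`-maps from `T` to `U`. -/
noncomputable def phi (T U : Frame G) : ℕ := Nat.card (T.Carrier →[G] U.Carrier)

/-- `U ≤ T` when there is a `G`-map from `T` to `U`. -/
instance : Preorder (Frame G) where
  le U T := Nonempty (T.Carrier →[G] U.Carrier)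
  le_refl _ := ⟨MulActionHom.id G⟩
  le_trans _ _ _ := fun ⟨f⟩ ⟨g⟩ => ⟨f.comp g⟩

theorem le_def {U T : Frame G} : U ≤ T ↔ Nonempty (T.Carrier →[G] U.Carrier) := Iff.rfl

theorem mk_rep (T : Frame G) : mk T.rep = T := Quotient.out_eq T

theorem exists_bijective_mk (K : OpenSubgroup G) :
    ∃ f : (G ⧸ K.toSubgroup) →[G] (mk K).Carrier, Function.Bijective f :=
  (frameSetoid G).symm (Quotient.mk_out (s := frameSetoid G) K)

theorem size_mk (K : OpenSubgroup G) : (mk K).size = Nat.card (G ⧸ K.toSubgroup) := by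
  obtain ⟨f, hf⟩ := exists_bijective_mk K
  exact (Nat.card_congr (Equiv.ofBijective f hf)).symm

/-- `G`-maps out of `G ⧸ K` correspond to points fixed by `K`. -/
noncomputable def homEquiv (K : Subgroup G) (Y : Type*) [MulAction G Y] :
    ((G ⧸ K) →[G] Y) ≃ {y : Y // ∀ k ∈ K, k • y = y} where
  toFun f := ⟨f ((1 : G) : G ⧸ K), fun k hk => by
    rw [← f.map_smul]
    congr 1
    exact QuotientGroup.eq.2 (by simpa using hk)⟩
  invFun y :=
    { toFun := fun x => Quotient.liftOn' x (fun g => g • y.1) (fun a b hab => by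
        have h := y.2 _ (QuotientGroup.leftRel_apply.1 hab)
        change a • y.1 = b • y.1
        rw [mul_smul, inv_smul_eq_iff] at h
        exact h.symm)
      map_smul' := fun g x => by
        induction x using QuotientGroup.induction_on with
        | H x => exact mul_smul g x y.1 }
  left_inv f := by
    ext x
    induction x using QuotientGroup.induction_on with
    | H x =>
      change x • f ((1 : G) : G ⧸ K) = _
      rw [← f.map_smul]
      congr 1
      exact congrArg _ (mul_one x)
  right_inv y := Subtype.ext (one_smul G y.1)

theorem phi_mk (K : OpenSubgroup G) (U : Frame G) :
    (mk K).phi U = Nat.card {y : U.Carrier // ∀ k ∈ K.toSubgroup, k • y = y} := by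
  obtain ⟨f, hf⟩ := exists_bijective_mk K
  obtain ⟨g, hl, hr⟩ := Function.bijective_iff_has_inverse.1 hf
  rw [← Nat.card_congr (homEquiv K.toSubgroup U.Carrier)]
  refine Nat.card_congr
    { toFun := fun h => h.comp f
      invFun := fun h => h.comp (f.inverse g hl hr)
      left_inv := fun h => ?_
      right_inv := fun h => ?_ }
  · ext x
    exact congrArg h (hr x)
  · ext x
    exact congrArg h (hl x)

theorem phi_zero_of_not_le {U T : Frame G} (h : ¬ U ≤ T) : T.phi U = 0 := by
  have : IsEmpty (T.Carrier →[G] U.Carrier) := not_nonempty_iff.1 h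
  exact Nat.card_of_isEmpty

theorem surjective_hom {U T : Frame G} (f : T.Carrier →[G] U.Carrier) : Function.Surjective f := by
  intro y
  obtain ⟨g, hg⟩ := MulAction.exists_smul_eq G (f ((1 : G) : T.Carrier)) y
  exact ⟨g • ((1 : G) : T.Carrier), by rw [f.map_smul, hg]⟩

variable [IsTopologicalGroup G] [CompactSpace G]

instance finite_quotient (K : OpenSubgroup G) : Finite (G ⧸ K.toSubgroup) :=
  Subgroup.quotient_finite_of_isOpen _ K.isOpen

instance finite_hom (T U : Frame G) : Finite (T.Carrier →[G] U.Carrier) :=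
  DFunLike.finite _

theorem size_pos (T : Frame G) : 0 < T.size := Nat.card_pos

theorem size_le_of_le {U T : Frame G} (h : U ≤ T) : U.size ≤ T.size := by
  obtain ⟨f⟩ := h
  exact Nat.card_le_card_of_surjective f (surjective_hom f)

theorem phi_pos {U T : Frame G} (h : U ≤ T) : 0 < T.phi U := by
  have : Nonempty (T.Carrier →[G] U.Carrier) := h
  exact Nat.card_pos

theorem eq_of_le_of_size {U T : Frame G} (h : U ≤ T) (hs : T.size ≤ U.size) : U = T := by
  obtain ⟨f⟩ := h
  have hb : Function.Bijective f := by
    refine (Nat.bijective_iff_surjective_and_card f).2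
      ⟨surjective_hom f, le_antisymm hs (size_le_of_le ⟨f⟩)⟩
  rw [← mk_rep U, ← mk_rep T]
  exact (Quotient.sound (s := frameSetoid G) ⟨f, hb⟩).symm

/-- Every open subgroup `K` containing `T.rep` is determined by a subset of `G ⧸ T.rep`. -/
theorem finite_le (T : Frame G) : {U : Frame G | U ≤ T}.Finite := by
  have h1 : Finite {K : OpenSubgroup G // T.rep ≤ K} := by
    refine Finite.of_injective
      (fun K : {K : OpenSubgroup G // T.rep ≤ K} => {x : T.Carrier | ∃ g ∈ K.1, (g : T.Carrier) = x})
      ?_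
    have key : ∀ K L : {K : OpenSubgroup G // T.rep ≤ K},
        {x : T.Carrier | ∃ g ∈ K.1, (g : T.Carrier) = x} =
          {x : T.Carrier | ∃ g ∈ L.1, (g : T.Carrier) = x} → K.1 ≤ L.1 := by
      intro K L hKL g hg
      have : (g : T.Carrier) ∈ {x : T.Carrier | ∃ g ∈ L.1, (g : T.Carrier) = x} :=
        hKL ▸ ⟨g, hg, rfl⟩
      obtain ⟨l, hl, hlg⟩ := this
      have h2 := L.1.mul_mem hl (L.2 (QuotientGroup.eq.1 hlg))
      rwa [mul_inv_cancel_left] at h2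
    intro K L hKL
    exact Subtype.ext (le_antisymm (key K L hKL) (key L K hKL.symm))
  refine (Set.finite_range (fun K : {K : OpenSubgroup G // T.rep ≤ K} => mk K.1)).subset ?_
  rintro U ⟨f⟩
  have hopen : IsOpen (MulAction.stabilizer G (f ((1 : G) : T.Carrier)) : Set G) := by
    refine Subgroup.isOpen_mono (H₁ := T.rep.toSubgroup) ?_ T.rep.isOpen
    intro h hh
    exact (homEquiv T.rep.toSubgroup U.Carrier f).2 h hh
  refine ⟨⟨⟨_, hopen⟩, fun h hh => (homEquiv T.rep.toSubgroup U.Carrier f).2 h hh⟩, ?_⟩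
  refine Eq.trans (Quotient.sound (s := frameSetoid G) ?_) (mk_rep U)
  refine ⟨(homEquiv _ U.Carrier).symm ⟨f ((1 : G) : T.Carrier), fun k hk => hk⟩, ?_⟩
  refine ⟨MulAction.injective_ofQuotientStabilizer G (f ((1 : G) : T.Carrier)), ?_⟩
  intro y
  obtain ⟨g, hg⟩ := MulAction.exists_smul_eq G (f ((1 : G) : T.Carrier)) y
  exact ⟨(g : G ⧸ MulAction.stabilizer G (f ((1 : G) : T.Carrier))), hg⟩

end Frame
end FrameDefs
section Integrality

namespace Frame

variable {G : Type*} [Group G] [TopologicalSpace G]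

/-- The group of automorphisms of the `G`-set `T`. -/
def aut (T : Frame G) : Subgroup (Equiv.Perm T.Carrier) where
  carrier := {q | ∀ (g : G) (x : T.Carrier), q (g • x) = g • q x}
  mul_mem' := fun {a b} ha hb g x => by
    rw [Equiv.Perm.mul_apply, hb, ha, Equiv.Perm.mul_apply]
  one_mem' := fun _ _ => rfl
  inv_mem' := fun {a} ha g x => by
    rw [Equiv.Perm.inv_eq_iff_eq, ha]
    exact congrArg _ (a.apply_symm_apply x).symm

/-- The base point of the coset space. -/
noncomputable def base (T : Frame G) : T.Carrier := ((1 : G) : T.Carrier)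

theorem exists_smul_base (T : Frame G) (x : T.Carrier) : ∃ g : G, g • T.base = x :=
  MulAction.exists_smul_eq G T.base x

theorem smul_base_eq (T : Frame G) {g : G} : g • T.base = T.base ↔ g ∈ T.rep := by
  change ((g * 1 : G) : T.Carrier) = ((1 : G) : T.Carrier) ↔ _
  rw [mul_one, eq_comm, QuotientGroup.eq, inv_one, one_mul]
  rfl

theorem aut_ext (T : Frame G) {q r : T.aut} (h : q.1 T.base = r.1 T.base) : q = r := by
  apply Subtype.ext
  ext1 x
  obtain ⟨g, rfl⟩ := T.exists_smul_base x
  rw [q.2, r.2, h]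

noncomputable instance (T U : Frame G) : MulAction T.aut (T.Carrier →[G] U.Carrier) where
  smul q f :=
    { toFun := fun x => f (q.1⁻¹ x)
      map_smul' := fun g x => by
        rw [(T.aut.inv_mem q.2) g x]
        exact f.map_smul g _ }
  one_smul _ := rfl
  mul_smul q r f := by
    ext x
    change f ((q.1 * r.1)⁻¹ x) = f (r.1⁻¹ (q.1⁻¹ x))
    rw [mul_inv_rev, Equiv.Perm.mul_apply]

theorem aut_smul_apply (T U : Frame G) (q : T.aut) (f : T.Carrier →[G] U.Carrier)
    (x : T.Carrier) : (q • f) x = f (q.1⁻¹ x) := rfl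

variable [IsTopologicalGroup G] [CompactSpace G]

theorem card_aut (T : Frame G) : Nat.card T.aut = T.phi T := by
  refine Nat.card_congr (Equiv.ofBijective
    (fun q : T.aut => (⟨q.1, q.2⟩ : T.Carrier →[G] T.Carrier)) ⟨?_, ?_⟩)
  · intro q r h
    exact T.aut_ext (DFunLike.congr_fun h T.base)
  · intro f
    refine ⟨⟨Equiv.ofBijective f ?_, fun g x => f.map_smul g x⟩, ?_⟩
    · exact Finite.injective_iff_bijective.1
        (Finite.injective_iff_surjective.2 (surjective_hom f))
    · ext x
      rfl

/-- The stabilizer of the class of the base point in the quotient of `T` by a group `S` of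
automorphisms of `T`. -/
def coverSubgroup (T : Frame G) (S : Subgroup T.aut) : Subgroup G where
  carrier := {g | ∃ s ∈ S, g • T.base = s.1 T.base}
  mul_mem' := by
    rintro a b ⟨s, hs, ha⟩ ⟨t, ht, hb⟩
    refine ⟨t * s, S.mul_mem ht hs, ?_⟩
    rw [mul_smul, hb, ← t.2, ha]
    rfl
  one_mem' := ⟨1, S.one_mem, one_smul _ _⟩
  inv_mem' := by
    rintro a ⟨s, hs, ha⟩
    refine ⟨s⁻¹, S.inv_mem hs, ?_⟩
    rw [inv_smul_eq_iff, ← (s⁻¹).2, ha]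
    exact (s.1.symm_apply_apply _).symm

/-- The subgroup `coverSubgroup` as an open subgroup. -/
def cover (T : Frame G) (S : Subgroup T.aut) : OpenSubgroup G where
  toSubgroup := T.coverSubgroup S
  isOpen' := Subgroup.isOpen_mono (H₁ := T.rep.toSubgroup) (H₂ := T.coverSubgroup S)
    (fun _ hh => ⟨1, S.one_mem, T.smul_base_eq.2 hh⟩) T.rep.isOpen

theorem mem_cover (T : Frame G) (S : Subgroup T.aut) (g : G) :
    g ∈ (T.cover S).toSubgroup ↔ ∃ s ∈ S, g • T.base = s.1 T.base := Iff.rfl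

theorem rep_le_cover (T : Frame G) (S : Subgroup T.aut) : T.rep ≤ T.cover S :=
  fun _ hh => ⟨1, S.one_mem, T.smul_base_eq.2 hh⟩

theorem card_cover (T : Frame G) (S : Subgroup T.aut) :
    (mk (T.cover S)).size * Nat.card S = T.size := by
  rw [size_mk]
  change (T.cover S).toSubgroup.index * _ = T.rep.toSubgroup.index
  rw [← Subgroup.relIndex_mul_index (show T.rep.toSubgroup ≤ (T.cover S).toSubgroup from
    T.rep_le_cover S), mul_comm]
  congr 1
  have h1 : T.rep.toSubgroup.subgroupOf (T.cover S).toSubgroup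
      = MulAction.stabilizer (T.cover S).toSubgroup T.base := by
    ext g
    rw [Subgroup.mem_subgroupOf, MulAction.mem_stabilizer_iff]
    exact T.smul_base_eq.symm
  rw [Subgroup.relIndex, h1, MulAction.index_stabilizer, ← Nat.card_coe_set_eq]
  refine Nat.card_congr (Equiv.ofBijective
    (fun s : S => (⟨s.1.1 T.base, ?_⟩ : MulAction.orbit (T.cover S).toSubgroup T.base)) ⟨?_, ?_⟩)
  · obtain ⟨g, hg⟩ := T.exists_smul_base (s.1.1 T.base)
    exact ⟨⟨g, ⟨s.1, s.2, hg⟩⟩, hg⟩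
  · intro s t h
    exact Subtype.ext (T.aut_ext (Subtype.ext_iff.1 h))
  · rintro ⟨_, ⟨g, ⟨s, hs, hg⟩⟩, rfl⟩
    exact ⟨⟨s, hs⟩, Subtype.ext hg.symm⟩

theorem forall_smul_eq_iff (T U : Frame G) (S : Subgroup T.aut) (f : T.Carrier →[G] U.Carrier) :
    (∀ s ∈ S, s • f = f) ↔ ∀ k ∈ (T.cover S).toSubgroup, k • f T.base = f T.base := by
  constructor
  · rintro h k ⟨s, hs, hk⟩
    rw [← f.map_smul, hk]
    have h1 := DFunLike.congr_fun (h s hs) (s.1 T.base)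
    rw [aut_smul_apply] at h1
    exact h1.symm.trans (congrArg f (s.1.symm_apply_apply _))
  · intro h s hs
    ext x
    obtain ⟨g, rfl⟩ := T.exists_smul_base x
    rw [(s • f).map_smul, f.map_smul, aut_smul_apply]
    obtain ⟨k, hk⟩ := T.exists_smul_base (s.1⁻¹ T.base)
    rw [← hk, f.map_smul, h k ⟨s⁻¹, S.inv_mem hs, hk⟩]

theorem card_fixed (T U : Frame G) (q : T.aut) :
    Nat.card {f : T.Carrier →[G] U.Carrier // q • f = f}
      = (mk (T.cover (Subgroup.zpowers q))).phi U := by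
  rw [phi_mk]
  have hz : ∀ f : T.Carrier →[G] U.Carrier,
      (q • f = f) ↔ ∀ s ∈ Subgroup.zpowers q, s • f = f := by
    intro f
    rw [← MulAction.mem_stabilizer_iff, ← Subgroup.zpowers_le]
    rfl
  refine Nat.card_congr (Equiv.ofBijective
    (fun f => ⟨f.1 T.base, (T.forall_smul_eq_iff U _ f.1).1 ((hz f.1).1 f.2)⟩) ⟨?_, ?_⟩)
  · intro f f' h
    apply Subtype.ext
    ext x
    obtain ⟨g, rfl⟩ := T.exists_smul_base x
    rw [f.1.map_smul, f'.1.map_smul]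
    exact congrArg (g • ·) (Subtype.ext_iff.1 h)
  · rintro ⟨y, hy⟩
    have hev := (homEquiv T.rep.toSubgroup U.Carrier).apply_symm_apply
      ⟨y, fun k hk => hy k (T.rep_le_cover _ hk)⟩
    generalize (homEquiv T.rep.toSubgroup U.Carrier).symm
      ⟨y, fun k hk => hy k (T.rep_le_cover _ hk)⟩ = f at hev
    have hfy : f T.base = y := Subtype.ext_iff.1 hev
    refine ⟨⟨f, (hz f).2 ((T.forall_smul_eq_iff U _ f).2 ?_)⟩, Subtype.ext hfy⟩
    rw [hfy]
    exact hy

theorem card_stabilizer_dvd (T U : Frame G) (S : Subgroup T.aut) (f : T.Carrier →[G] U.Carrier)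
    (h : ∀ s ∈ S, s • f = f) : Nat.card S ∣ T.size / U.size := by
  have h1 : (T.cover S).toSubgroup ≤ MulAction.stabilizer G (f T.base) :=
    (T.forall_smul_eq_iff U S f).1 h
  have h2 : U.size = (MulAction.stabilizer G (f T.base)).index := by
    rw [MulAction.index_stabilizer, MulAction.orbit_eq_univ, Set.ncard_univ]
    rfl
  obtain ⟨c, hc⟩ := Subgroup.index_dvd_of_le h1
  have h3 : (mk (T.cover S)).size = U.size * c := by
    rw [size_mk, h2, ← hc]
    rfl
  rw [← T.card_cover S, h3, mul_assoc, Nat.mul_div_cancel_left _ U.size_pos]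
  exact dvd_mul_left _ _

end Frame

open WittBurnside.Frame

variable {G : Type*} [Group G] [TopologicalSpace G] [IsTopologicalGroup G] [CompactSpace G]

/-- The Witt polynomial of `T`: the sum cover `U ≤ T` of
`phi T U * X U ^ (size T / size U)`. -/
noncomputable def wittPoly (T : Frame G) : MvPolynomial (Frame G) ℤ :=
  ∑ U ∈ (finite_le T).toFinset,
    MvPolynomial.C (T.phi U : ℤ) * MvPolynomial.X U ^ (T.size / U.size)

/-- The ghost component `T` of a vector. -/
noncomputable def ghost {A : Type*} [CommRing A] (a : Frame G → A) (T : Frame G) : A :=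
  MvPolynomial.aeval a (wittPoly T)

theorem ghost_eq {A : Type*} [CommRing A] (a : Frame G → A) (T : Frame G) :
    ghost a T = ∑ U ∈ (finite_le T).toFinset, (T.phi U : A) * a U ^ (T.size / U.size) := by
  simp [ghost, wittPoly]

theorem ghost_eq_of_le {A : Type*} [CommRing A] (a : Frame G → A) {V T : Frame G} (h : V ≤ T) :
    ghost a V = ∑ U ∈ (finite_le T).toFinset, (V.phi U : A) * a U ^ (V.size / U.size) := by
  rw [ghost_eq]
  refine Finset.sum_subset ?_ ?_
  · intro U hU
    simp only [Set.Finite.mem_toFinset, Set.mem_ofPred_eq] at hU ⊢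
    exact hU.trans h
  · intro U _ hU
    simp only [Set.Finite.mem_toFinset, Set.mem_ofPred_eq] at hU
    rw [phi_zero_of_not_le hU, Nat.cast_zero, zero_mul]

theorem ghost_congr {A : Type*} [CommRing A] {a b : Frame G → A} {T : Frame G}
    (h : ∀ U ≤ T, a U = b U) : ghost a T = ghost b T := by
  rw [ghost_eq, ghost_eq]
  refine Finset.sum_congr rfl fun U hU => ?_
  rw [h U (by simpa using hU)]

theorem ghost_succ {A : Type*} [CommRing A] (a : Frame G → A) (T : Frame G) :
    ∃ r : A, ghost a T = T.phi T * a T + r ∧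
      ∀ b : Frame G → A, (∀ U < T, a U = b U) → ghost b T = T.phi T * b T + r := by
  classical
  have hT : T ∈ (finite_le T).toFinset := by simp
  refine ⟨∑ U ∈ (finite_le T).toFinset.erase T, (T.phi U : A) * a U ^ (T.size / U.size), ?_, ?_⟩
  · rw [ghost_eq, ← Finset.add_sum_erase _ _ hT, Nat.div_self T.size_pos, pow_one]
  · intro b hb
    rw [ghost_eq, ← Finset.add_sum_erase _ _ hT, Nat.div_self T.size_pos, pow_one]
    congr 1
    refine Finset.sum_congr rfl fun U hU => ?_
    obtain ⟨hne, hU⟩ := Finset.mem_erase.1 hU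
    have hle : U ≤ T := by simpa using hU
    rw [hb U (lt_of_le_not_ge hle fun h => hne (eq_of_le_of_size hle (size_le_of_le h)))]

theorem size_lt_of_lt {U T : Frame G} (h : U < T) : U.size < T.size := by
  by_contra hc
  have := eq_of_le_of_size h.le (not_lt.1 hc)
  exact absurd h (this ▸ lt_irrefl U)

/-- The congruences that characterize ghost vectors cover a polynomial ring. -/
def IsCongr {σ : Type*} (f : Frame G → MvPolynomial σ ℤ) : Prop :=
  ∀ (T : Frame G) (_ : Fintype T.aut), (T.phi T : MvPolynomial σ ℤ) ∣
    ∑ q : T.aut, MvPolynomial.expand (orderOf q) (f (mk (T.cover (Subgroup.zpowers q))))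

theorem IsCongr.add {σ : Type*} {f g : Frame G → MvPolynomial σ ℤ} (hf : IsCongr f)
    (hg : IsCongr g) : IsCongr (f + g) := by
  intro T _
  simp only [Pi.add_apply, map_add, Finset.sum_add_distrib]
  exact dvd_add (hf T _) (hg T _)

theorem IsCongr.neg {σ : Type*} {f : Frame G → MvPolynomial σ ℤ} (hf : IsCongr f) :
    IsCongr (-f) := by
  intro T _
  simp only [Pi.neg_apply, map_neg, Finset.sum_neg_distrib]
  exact (dvd_neg).2 (hf T _)

theorem cover_size_div (T U : Frame G) (q : T.aut) :
    (mk (T.cover (Subgroup.zpowers q))).size / U.size = (T.size / U.size) / orderOf q := by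
  have : Finite T.aut := Subtype.finite
  rw [← T.card_cover (Subgroup.zpowers q), Nat.card_zpowers, Nat.div_div_eq_div_mul,
    mul_comm U.size, ← Nat.div_div_eq_div_mul, Nat.mul_div_cancel _ (orderOf_pos q)]

theorem mk_cover_le (T : Frame G) (S : Subgroup T.aut) : mk (T.cover S) ≤ T := by
  obtain ⟨f, hf⟩ := exists_bijective_mk (T.cover S)
  exact ⟨f.comp ((homEquiv T.rep.toSubgroup _).symm ⟨((1 : G) : G ⧸ (T.cover S).toSubgroup),
    fun k hk => (homEquiv (T.cover S).toSubgroup _ (MulActionHom.id G)).2 k (T.rep_le_cover S hk)⟩)⟩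

theorem isCongr_ghost_mul {σ : Type*} (a b : Frame G → MvPolynomial σ ℤ) :
    IsCongr (ghost a * ghost b) := by
  intro T _
  classical
  have : Finite T.aut := Subtype.finite
  have hrw : ∀ q : T.aut, MvPolynomial.expand (orderOf q)
      ((ghost a * ghost b) (mk (T.cover (Subgroup.zpowers q)))) =
      ∑ U ∈ (finite_le T).toFinset, ∑ V ∈ (finite_le T).toFinset,
        (Nat.card {z : (T.Carrier →[G] U.Carrier) × (T.Carrier →[G] V.Carrier) // q • z = z} :
          MvPolynomial σ ℤ) * MvPolynomial.expand (orderOf q)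
            (a U ^ ((T.size / U.size) / orderOf q) * b V ^ ((T.size / V.size) / orderOf q)) := by
    intro q
    rw [Pi.mul_apply, ghost_eq_of_le a (mk_cover_le T _), ghost_eq_of_le b (mk_cover_le T _),
      Finset.sum_mul_sum, map_sum]
    refine Finset.sum_congr rfl fun U _ => ?_
    rw [map_sum]
    refine Finset.sum_congr rfl fun V _ => ?_
    have hc : Nat.card {z : (T.Carrier →[G] U.Carrier) × (T.Carrier →[G] V.Carrier) // q • z = z}
        = (mk (T.cover (Subgroup.zpowers q))).phi U * (mk (T.cover (Subgroup.zpowers q))).phi V := by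
      rw [← card_fixed, ← card_fixed, ← Nat.card_prod]
      refine Nat.card_congr
        { toFun := fun z => (⟨z.1.1, congrArg Prod.fst z.2⟩, ⟨z.1.2, congrArg Prod.snd z.2⟩)
          invFun := fun z => ⟨(z.1.1, z.2.1), Prod.ext z.1.2 z.2.2⟩
          left_inv := fun _ => rfl
          right_inv := fun _ => rfl }
    rw [hc, cover_size_div, cover_size_div]
    simp only [map_mul, map_natCast, Nat.cast_mul]
    ring
  simp only [hrw]
  rw [Finset.sum_comm]
  refine Finset.dvd_sum fun U _ => ?_
  rw [Finset.sum_comm]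
  refine Finset.dvd_sum fun V _ => ?_
  have := Fintype.ofFinite ((T.Carrier →[G] U.Carrier) × (T.Carrier →[G] V.Carrier))
  rw [← card_aut]
  refine action_dvd (a U) (b V) _ _ (fun z => ?_) (fun z => ?_)
  · exact T.card_stabilizer_dvd U _ z.1 fun s hs => congrArg Prod.fst hs
  · exact T.card_stabilizer_dvd V _ z.2 fun s hs => congrArg Prod.snd hs

/-- The vector with entry `1` at the class of the one-point `G`-set and `0` elsewhere. -/
noncomputable def oneVec (A : Type*) [CommRing A] : Frame G → A := by
  classical exact fun T => if T = mk ⊤ then 1 else 0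

theorem ghost_one (A : Type*) [CommRing A] : ghost (oneVec A : Frame G → A) = 1 := by
  classical
  funext T
  have hsub : Subsingleton (mk (⊤ : OpenSubgroup G)).Carrier := by
    obtain ⟨f, hf⟩ := exists_bijective_mk (⊤ : OpenSubgroup G)
    have : Subsingleton (G ⧸ (⊤ : OpenSubgroup G).toSubgroup) :=
      QuotientGroup.subsingleton_quotient_top
    exact hf.surjective.subsingleton
  let f₀ : T.Carrier →[G] (mk (⊤ : OpenSubgroup G)).Carrier :=
    ⟨fun _ => (mk ⊤).base, fun _ _ => Subsingleton.elim _ _⟩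
  have hle : mk ⊤ ≤ T := ⟨f₀⟩
  have hphi : T.phi (mk ⊤) = 1 := by
    refine Nat.card_eq_one_iff_unique.2 ⟨⟨fun a b => ?_⟩, ⟨f₀⟩⟩
    ext x
    exact Subsingleton.elim _ _
  rw [ghost_eq, Finset.sum_eq_single (mk ⊤)]
  · simp [oneVec, hphi]
  · intro U hU hne
    have hU2 : U ≤ T := by simpa using hU
    have : T.size / U.size ≠ 0 := (Nat.div_pos (size_le_of_le hU2) U.size_pos).ne'
    simp [oneVec, hne, this]
  · intro h
    exact absurd (by simpa using hle) h

theorem ghost_zero (A : Type*) [CommRing A] : ghost (0 : Frame G → A) = 0 := by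
  funext T
  rw [ghost_eq]
  refine Finset.sum_eq_zero fun U hU => ?_
  have hU2 : U ≤ T := by simpa using hU
  have : T.size / U.size ≠ 0 := (Nat.div_pos (size_le_of_le hU2) U.size_pos).ne'
  simp [this]

theorem isCongr_ghost {σ : Type*} (a : Frame G → MvPolynomial σ ℤ) : IsCongr (ghost a) := by
  have := isCongr_ghost_mul a (oneVec _)
  rwa [ghost_one, mul_one] at this

theorem exists_ghost_eq {σ : Type*} {f : Frame G → MvPolynomial σ ℤ} (hf : IsCongr f) :
    ∃ a, ghost a = f := by
  classical
  let step : (T : Frame G) → ((U : Frame G) → U.size < T.size → MvPolynomial σ ℤ) →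
      MvPolynomial σ ℤ := fun T ih => Classical.epsilon fun x =>
    ghost (fun U => if h : U.size < T.size then ih U h else if U = T then x else 0) T = f T
  let wf : WellFounded (fun U T : Frame G => U.size < T.size) := (measure Frame.size).wf
  let a : Frame G → MvPolynomial σ ℤ := wf.fix step
  have ha : ∀ T, a T = Classical.epsilon fun x =>
      ghost (fun U => if U.size < T.size then a U else if U = T then x else 0) T = f T := by
    intro T
    have := wf.fix_eq step T
    exact this
  refine ⟨a, funext fun T => ?_⟩
  induction hn : T.size using Nat.strong_induction_on generalizing T with
  | _ n ih =>
  subst hn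
  have hex : ∃ x, ghost (fun U => if U.size < T.size then a U else if U = T then x else 0) T
      = f T := by
    let b : Frame G → MvPolynomial σ ℤ := fun U => if U.size < T.size then a U else 0
    have hbT : b T = 0 := by simp [b]
    have hfin : Finite T.aut := Subtype.finite
    let _ := Fintype.ofFinite T.aut
    have hg := (hf.add (isCongr_ghost b).neg) T inferInstance
    rw [Finset.sum_eq_single 1] at hg
    · have h1 : mk (T.cover (Subgroup.zpowers 1)) = T := by
        refine eq_of_le_of_size (mk_cover_le T _) ?_
        rw [← T.card_cover (Subgroup.zpowers 1)]
        simp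
      rw [h1, orderOf_one, MvPolynomial.expand_one_apply] at hg
      obtain ⟨x, hx⟩ := hg
      obtain ⟨r, hr, hr'⟩ := ghost_succ b T
      refine ⟨x, ?_⟩
      rw [hr' _ fun U hU => ?_]
      · rw [hbT, mul_zero, zero_add] at hr
        simp only [lt_irrefl, if_false, if_true, ← hr, ← hx, Pi.add_apply, Pi.neg_apply]
        ring
      · simp [b, size_lt_of_lt hU]
    · intro q _ hq
      have h1 : 1 < orderOf q := by
        have := orderOf_pos q
        have h2 : orderOf q ≠ 1 := fun h => hq (orderOf_eq_one_iff.1 h)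
        omega
      have h2 : (mk (T.cover (Subgroup.zpowers q))).size < T.size := by
        rw [← T.card_cover (Subgroup.zpowers q), Nat.card_zpowers]
        exact lt_mul_of_one_lt_right (size_pos _) h1
      rw [Pi.add_apply, Pi.neg_apply, ← ih _ h2 _ rfl, ghost_congr (a := b) (b := a),
        add_neg_cancel, map_zero]
      intro U hU
      simp [b, (size_le_of_le hU).trans_lt h2]
    · simp
  have hx := Classical.epsilon_spec hex
  rw [← ha T] at hx
  rw [← hx]
  refine ghost_congr fun U hU => ?_
  by_cases h : U.size < T.size
  · simp [h]
  · have := eq_of_le_of_size hU (not_lt.1 h)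
    subst this
    simp

theorem eq_of_ghost_eq {A : Type*} [CommRing A] [IsDomain A] [CharZero A] {a b : Frame G → A}
    (D : LowerSet (Frame G)) (h : ∀ T ∈ D, ghost a T = ghost b T) : ∀ T ∈ D, a T = b T := by
  intro T hT
  induction hn : T.size using Nat.strong_induction_on generalizing T with
  | _ n ih =>
  subst hn
  obtain ⟨r, hr, hr'⟩ := ghost_succ a T
  have hb := hr' b fun U hU => ih _ (size_lt_of_lt hU) U (D.lower hU.le hT) rfl
  have := h T hT
  rw [hr, hb] at this
  exact mul_left_cancel₀ (Nat.cast_ne_zero.2 (phi_pos le_rfl).ne') (add_right_cancel this)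

theorem ghost_injective {A : Type*} [CommRing A] [IsDomain A] [CharZero A] :
    Function.Injective (ghost : (Frame G → A) → Frame G → A) := by
  intro a b h
  funext T
  exact eq_of_ghost_eq ⊤ (fun T _ => congrFun h T) T trivial

theorem ghost_X {σ : Type*} (i : Frame G → σ) (T : Frame G) :
    ghost (fun U => (MvPolynomial.X (i U) : MvPolynomial σ ℤ)) T
      = MvPolynomial.rename i (wittPoly T) := by
  rw [← MvPolynomial.aeval_X_left_apply (MvPolynomial.rename i (wittPoly T)),
    MvPolynomial.aeval_rename]
  rfl

/-- Existence and uniqueness of the integral Witt addition polynomials. -/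
theorem exists_wittAdd (G : Type*) [Group G] [TopologicalSpace G] [IsTopologicalGroup G]
    [CompactSpace G] : ∃! S : Frame G → MvPolynomial (Frame G ⊕ Frame G) ℤ,
    ∀ T, MvPolynomial.bind₁ S (wittPoly T) =
      MvPolynomial.rename Sum.inl (wittPoly T) + MvPolynomial.rename Sum.inr (wittPoly T) := by
  simp only [← ghost_X]
  obtain ⟨S, hS⟩ := exists_ghost_eq ((isCongr_ghost fun T : Frame G =>
    (MvPolynomial.X (Sum.inl T) : MvPolynomial (Frame G ⊕ Frame G) ℤ)).add
    (isCongr_ghost fun T => MvPolynomial.X (Sum.inr T)))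
  refine ⟨S, fun T => congrFun hS T, fun S' h => ghost_injective ?_⟩
  rw [hS]
  exact funext h

/-- Existence and uniqueness of the integral Witt multiplication polynomials. -/
theorem exists_wittMul (G : Type*) [Group G] [TopologicalSpace G] [IsTopologicalGroup G]
    [CompactSpace G] : ∃! M : Frame G → MvPolynomial (Frame G ⊕ Frame G) ℤ,
    ∀ T, MvPolynomial.bind₁ M (wittPoly T) =
      MvPolynomial.rename Sum.inl (wittPoly T) * MvPolynomial.rename Sum.inr (wittPoly T) := by
  simp only [← ghost_X]
  obtain ⟨S, hS⟩ := exists_ghost_eq (isCongr_ghost_mul (fun T : Frame G =>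
    (MvPolynomial.X (Sum.inl T) : MvPolynomial (Frame G ⊕ Frame G) ℤ))
    (fun T => MvPolynomial.X (Sum.inr T)))
  refine ⟨S, fun T => congrFun hS T, fun S' h => ghost_injective ?_⟩
  rw [hS]
  exact funext h

/-- Existence and uniqueness of the integral polynomials for additive inverses. -/
theorem exists_wittNeg (G : Type*) [Group G] [TopologicalSpace G] [IsTopologicalGroup G]
    [CompactSpace G] : ∃! S : Frame G → MvPolynomial (Frame G) ℤ,
    ∀ T, MvPolynomial.bind₁ S (wittPoly T) = -wittPoly T := by
  obtain ⟨S, hS⟩ := exists_ghost_eq (isCongr_ghost fun T : Frame G =>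
    (MvPolynomial.X T : MvPolynomial (Frame G) ℤ)).neg
  have hX : ∀ T : Frame G, ghost (fun T : Frame G => (MvPolynomial.X T : MvPolynomial _ ℤ)) T
      = wittPoly T := fun T => MvPolynomial.aeval_X_left_apply _
  refine ⟨S, fun T => (congrFun hS T).trans (congrArg Neg.neg (hX T)), fun S' h => ghost_injective ?_⟩
  rw [hS]
  exact funext fun T => (h T).trans (congrArg Neg.neg (hX T).symm)

/-- The Witt addition polynomials. -/
noncomputable def wittAdd (T : Frame G) : MvPolynomial (Frame G ⊕ Frame G) ℤ :=
  (exists_wittAdd G).exists.choose T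

/-- The Witt multiplication polynomials. -/
noncomputable def wittMul (T : Frame G) : MvPolynomial (Frame G ⊕ Frame G) ℤ :=
  (exists_wittMul G).exists.choose T

/-- The polynomials computing additive inverses. -/
noncomputable def wittNeg (T : Frame G) : MvPolynomial (Frame G) ℤ :=
  (exists_wittNeg G).exists.choose T

theorem wittAdd_spec (T : Frame G) : MvPolynomial.bind₁ wittAdd (wittPoly T) =
    MvPolynomial.rename Sum.inl (wittPoly T) + MvPolynomial.rename Sum.inr (wittPoly T) :=
  (exists_wittAdd G).exists.choose_spec T

theorem wittMul_spec (T : Frame G) : MvPolynomial.bind₁ wittMul (wittPoly T) =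
    MvPolynomial.rename Sum.inl (wittPoly T) * MvPolynomial.rename Sum.inr (wittPoly T) :=
  (exists_wittMul G).exists.choose_spec T

theorem wittNeg_spec (T : Frame G) : MvPolynomial.bind₁ wittNeg (wittPoly T) = -wittPoly T :=
  (exists_wittNeg G).exists.choose_spec T

end Integrality

section WittRing

/-- The Witt-Burnside ring of `G` with coefficients in `A`: families of elements of `A` indexed by
the frame of `G`, with operations given by the Witt addition and multiplication polynomials. -/
@[ext]
structure WittRing (G : Type*) [Group G] [TopologicalSpace G] (A : Type*) where
  /-- The coordinates. -/
  coeff : Frame G → A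

namespace WittRing

variable {G : Type*} [Group G] [TopologicalSpace G] [IsTopologicalGroup G] [CompactSpace G]
  {A B : Type*} [CommRing A] [CommRing B]

noncomputable instance : Zero (WittRing G A) := ⟨⟨0⟩⟩

noncomputable instance : One (WittRing G A) := ⟨⟨oneVec A⟩⟩

noncomputable instance : Add (WittRing G A) :=
  ⟨fun a b => ⟨fun T => MvPolynomial.aeval (Sum.elim a.coeff b.coeff) (wittAdd T)⟩⟩

noncomputable instance : Mul (WittRing G A) :=
  ⟨fun a b => ⟨fun T => MvPolynomial.aeval (Sum.elim a.coeff b.coeff) (wittMul T)⟩⟩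

noncomputable instance : Neg (WittRing G A) :=
  ⟨fun a => ⟨fun T => MvPolynomial.aeval a.coeff (wittNeg T)⟩⟩

theorem ghost_coeff_zero : ghost (0 : WittRing G A).coeff = 0 := ghost_zero A

theorem ghost_coeff_one : ghost (1 : WittRing G A).coeff = 1 := ghost_one A

theorem ghost_coeff_add (a b : WittRing G A) :
    ghost (a + b).coeff = ghost a.coeff + ghost b.coeff := by
  funext T
  have h := congrArg (MvPolynomial.aeval (Sum.elim a.coeff b.coeff)) (wittAdd_spec T)
  rw [MvPolynomial.aeval_bind₁, map_add, MvPolynomial.aeval_rename, MvPolynomial.aeval_rename,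
    Sum.elim_comp_inl, Sum.elim_comp_inr] at h
  exact h

theorem ghost_coeff_mul (a b : WittRing G A) :
    ghost (a * b).coeff = ghost a.coeff * ghost b.coeff := by
  funext T
  have h := congrArg (MvPolynomial.aeval (Sum.elim a.coeff b.coeff)) (wittMul_spec T)
  rw [MvPolynomial.aeval_bind₁, map_mul, MvPolynomial.aeval_rename, MvPolynomial.aeval_rename,
    Sum.elim_comp_inl, Sum.elim_comp_inr] at h
  exact h

theorem ghost_coeff_neg (a : WittRing G A) : ghost (-a).coeff = -ghost a.coeff := by
  funext T
  have h := congrArg (MvPolynomial.aeval a.coeff) (wittNeg_spec T)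
  rw [MvPolynomial.aeval_bind₁, map_neg] at h
  exact h

/-- A ring homomorphism applied to all coordinates. -/
def map (f : A →+* B) (a : WittRing G A) : WittRing G B := ⟨fun T => f (a.coeff T)⟩

theorem map_aeval {σ : Type*} (f : A →+* B) (v : σ → A) (p : MvPolynomial σ ℤ) :
    f (MvPolynomial.aeval v p) = MvPolynomial.aeval (fun i => f (v i)) p :=
  MvPolynomial.comp_aeval_apply v f.toIntAlgHom p

theorem map_zero' (f : A →+* B) : map f (0 : WittRing G A) = 0 :=
  WittRing.ext (funext fun _ => f.map_zero)

theorem map_one' (f : A →+* B) : map f (1 : WittRing G A) = 1 := by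
  classical
  refine WittRing.ext (funext fun T => ?_)
  change f (oneVec A T) = oneVec B T
  unfold oneVec
  split_ifs <;> simp

theorem map_add' (f : A →+* B) (a b : WittRing G A) : map f (a + b) = map f a + map f b := by
  refine WittRing.ext (funext fun T => ?_)
  refine (map_aeval f _ _).trans ?_
  congr 2
  funext i
  cases i <;> rfl

theorem map_mul' (f : A →+* B) (a b : WittRing G A) : map f (a * b) = map f a * map f b := by
  refine WittRing.ext (funext fun T => ?_)
  refine (map_aeval f _ _).trans ?_
  congr 2
  funext i
  cases i <;> rfl

theorem map_neg' (f : A →+* B) (a : WittRing G A) : map f (-a) = -map f a :=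
  WittRing.ext (funext fun _ => map_aeval f _ _)

/-- The evaluation homomorphism from the polynomial ring on the elements of `A`. -/
noncomputable def eval (A : Type*) [CommRing A] : MvPolynomial A ℤ →+* A :=
  (MvPolynomial.aeval (id : A → A) : MvPolynomial A ℤ →ₐ[ℤ] A).toRingHom

theorem exists_lift (a : WittRing G A) : ∃ a' : WittRing G (MvPolynomial A ℤ),
    map (eval A) a' = a ∧ ∀ T, a.coeff T = 0 → a'.coeff T = 0 := by
  classical
  refine ⟨⟨fun T => if a.coeff T = 0 then 0 else MvPolynomial.X (a.coeff T)⟩, ?_, ?_⟩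
  · refine WittRing.ext (funext fun T => ?_)
    change eval A (if a.coeff T = 0 then 0 else MvPolynomial.X (a.coeff T)) = a.coeff T
    split_ifs with h
    · rw [h, map_zero]
    · exact MvPolynomial.aeval_X _ _
  · intro T h
    simp [h]

theorem ext_ghost {a b : WittRing G (MvPolynomial A ℤ)} (h : ghost a.coeff = ghost b.coeff) :
    a = b := WittRing.ext (ghost_injective h)

noncomputable instance : CommRing (WittRing G A) where
  add_assoc a b c := by
    obtain ⟨a, rfl, _⟩ := exists_lift a
    obtain ⟨b, rfl, _⟩ := exists_lift b
    obtain ⟨c, rfl, _⟩ := exists_lift c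
    simp only [← map_add']
    refine congrArg (map (eval A)) (ext_ghost ?_)
    simp only [ghost_coeff_add, add_assoc]
  zero_add a := by
    obtain ⟨a, rfl, _⟩ := exists_lift a
    rw [← map_zero' (eval A), ← map_add']
    refine congrArg (map (eval A)) (ext_ghost ?_)
    simp only [ghost_coeff_add, ghost_coeff_zero, zero_add]
  add_zero a := by
    obtain ⟨a, rfl, _⟩ := exists_lift a
    rw [← map_zero' (eval A), ← map_add']
    refine congrArg (map (eval A)) (ext_ghost ?_)
    simp only [ghost_coeff_add, ghost_coeff_zero, add_zero]
  nsmul := nsmulRec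
  zsmul := zsmulRec
  add_comm a b := by
    obtain ⟨a, rfl, _⟩ := exists_lift a
    obtain ⟨b, rfl, _⟩ := exists_lift b
    simp only [← map_add']
    refine congrArg (map (eval A)) (ext_ghost ?_)
    simp only [ghost_coeff_add, add_comm]
  neg_add_cancel a := by
    obtain ⟨a, rfl, _⟩ := exists_lift a
    rw [← map_zero' (eval A), ← map_neg', ← map_add']
    refine congrArg (map (eval A)) (ext_ghost ?_)
    simp only [ghost_coeff_add, ghost_coeff_neg, ghost_coeff_zero, neg_add_cancel]
  mul_assoc a b c := by
    obtain ⟨a, rfl, _⟩ := exists_lift a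
    obtain ⟨b, rfl, _⟩ := exists_lift b
    obtain ⟨c, rfl, _⟩ := exists_lift c
    simp only [← map_mul']
    refine congrArg (map (eval A)) (ext_ghost ?_)
    simp only [ghost_coeff_mul, mul_assoc]
  mul_comm a b := by
    obtain ⟨a, rfl, _⟩ := exists_lift a
    obtain ⟨b, rfl, _⟩ := exists_lift b
    simp only [← map_mul']
    refine congrArg (map (eval A)) (ext_ghost ?_)
    simp only [ghost_coeff_mul, mul_comm]
  one_mul a := by
    obtain ⟨a, rfl, _⟩ := exists_lift a
    rw [← map_one' (eval A), ← map_mul']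
    refine congrArg (map (eval A)) (ext_ghost ?_)
    simp only [ghost_coeff_mul, ghost_coeff_one, one_mul]
  mul_one a := by
    obtain ⟨a, rfl, _⟩ := exists_lift a
    rw [← map_one' (eval A), ← map_mul']
    refine congrArg (map (eval A)) (ext_ghost ?_)
    simp only [ghost_coeff_mul, ghost_coeff_one, mul_one]
  zero_mul a := by
    obtain ⟨a, rfl, _⟩ := exists_lift a
    rw [← map_zero' (eval A), ← map_mul']
    refine congrArg (map (eval A)) (ext_ghost ?_)
    simp only [ghost_coeff_mul, ghost_coeff_zero, zero_mul]
  mul_zero a := by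
    obtain ⟨a, rfl, _⟩ := exists_lift a
    rw [← map_zero' (eval A), ← map_mul']
    refine congrArg (map (eval A)) (ext_ghost ?_)
    simp only [ghost_coeff_mul, ghost_coeff_zero, mul_zero]
  left_distrib a b c := by
    obtain ⟨a, rfl, _⟩ := exists_lift a
    obtain ⟨b, rfl, _⟩ := exists_lift b
    obtain ⟨c, rfl, _⟩ := exists_lift c
    simp only [← map_mul', ← map_add']
    refine congrArg (map (eval A)) (ext_ghost ?_)
    simp only [ghost_coeff_mul, ghost_coeff_add, mul_add]
  right_distrib a b c := by
    obtain ⟨a, rfl, _⟩ := exists_lift a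
    obtain ⟨b, rfl, _⟩ := exists_lift b
    obtain ⟨c, rfl, _⟩ := exists_lift c
    simp only [← map_mul', ← map_add']
    refine congrArg (map (eval A)) (ext_ghost ?_)
    simp only [ghost_coeff_mul, ghost_coeff_add, add_mul]

/-- The coordinates in a lower set `D` of an element vanish when its ghost components in `D` do. -/
theorem coeff_eq_zero {D : LowerSet (Frame G)} {a : WittRing G (MvPolynomial A ℤ)}
    (h : ∀ T ∈ D, ghost a.coeff T = 0) : ∀ T ∈ D, a.coeff T = 0 := by
  refine eq_of_ghost_eq (b := (0 : Frame G → MvPolynomial A ℤ)) D fun T hT => ?_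
  rw [h T hT, ghost_zero]
  rfl

theorem ghost_eq_zero {D : LowerSet (Frame G)} {a : WittRing G A}
    (h : ∀ T ∈ D, a.coeff T = 0) : ∀ T ∈ D, ghost a.coeff T = 0 := by
  intro T hT
  rw [ghost_congr (b := (0 : Frame G → A)) fun U hU => h U (D.lower hU hT), ghost_zero]
  rfl

/-- The ideal of elements whose coordinates in the lower set `D` are all zero. -/
def vanishingIdeal (A : Type*) [CommRing A] (D : LowerSet (Frame G)) : Ideal (WittRing G A) where
  carrier := {a | ∀ T ∈ D, a.coeff T = 0}
  zero_mem' := fun _ _ => rfl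
  add_mem' := by
    intro a b ha hb T hT
    obtain ⟨a, rfl, ha'⟩ := exists_lift a
    obtain ⟨b, rfl, hb'⟩ := exists_lift b
    rw [← map_add']
    have h : (a + b).coeff T = 0 := by
      refine coeff_eq_zero (D := D) (fun U hU => ?_) T hT
      rw [ghost_coeff_add, Pi.add_apply, ghost_eq_zero (fun V hV => ha' V (ha V hV)) U hU,
        ghost_eq_zero (fun V hV => hb' V (hb V hV)) U hU, add_zero]
    exact (congrArg _ h).trans (map_zero (eval A))
  smul_mem' := by
    intro c a ha T hT
    obtain ⟨a, rfl, ha'⟩ := exists_lift a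
    obtain ⟨c, rfl, _⟩ := exists_lift c
    rw [smul_eq_mul, ← map_mul']
    have h : (c * a).coeff T = 0 := by
      refine coeff_eq_zero (D := D) (fun U hU => ?_) T hT
      rw [ghost_coeff_mul, Pi.mul_apply, ghost_eq_zero (fun V hV => ha' V (ha V hV)) U hU, mul_zero]
    exact (congrArg _ h).trans (map_zero (eval A))

/-- The ideal `K_N`, the kernel of the projection from the Witt-Burnside ring of `G` to that of
`G ⧸ N`: the elements whose coordinate at `T` is zero whenever `N` acts trivially on `T`. -/
def K (A : Type*) [CommRing A] (N : Subgroup G) : Ideal (WittRing G A) :=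
  vanishingIdeal A
    { carrier := {T : Frame G | ∀ n ∈ N, ∀ x : T.Carrier, n • x = x}
      lower' := by
        rintro T U ⟨f⟩ hT n hn x
        obtain ⟨y, rfl⟩ := Frame.surjective_hom f x
        rw [← f.map_smul, hT n hn] }

theorem mem_K (N : Subgroup G) (a : WittRing G A) : a ∈ K A N ↔
    ∀ T : Frame G, (∀ n ∈ N, ∀ x : T.Carrier, n • x = x) → a.coeff T = 0 := Iff.rfl

/-- The ideal `I_n` of elements whose coordinate at `T` is zero whenever `T` has fewer than `n`
elements. -/
def I (G : Type*) [Group G] [TopologicalSpace G] [IsTopologicalGroup G] [CompactSpace G]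
    (A : Type*) [CommRing A] (n : ℕ) : Ideal (WittRing G A) :=
  vanishingIdeal A
    { carrier := {T : Frame G | T.size < n}
      lower' := fun _ _ h hT => (Frame.size_le_of_le h).trans_lt hT }

theorem mem_I (n : ℕ) (a : WittRing G A) : a ∈ I G A n ↔
    ∀ T : Frame G, T.size < n → a.coeff T = 0 := Iff.rfl

theorem I_antitone : Antitone (I G A) :=
  fun _ _ h _ ha T hT => ha T (lt_of_lt_of_le hT h)

end WittRing

variable (G : Type*) [Group G] [TopologicalSpace G] [IsTopologicalGroup G] [CompactSpace G]
  (A : Type*) [CommRing A]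

/-- The profinite topology: the topology induced by the map from the Witt-Burnside ring to the
product of the quotients by `K_N`, for `N` open normal, each quotient being discrete. -/
@[reducible]
noncomputable def profiniteTopology : TopologicalSpace (WittRing G A) :=
  TopologicalSpace.induced
    (fun a (N : OpenNormalSubgroup G) => Ideal.Quotient.mk (WittRing.K A N.toSubgroup) a)
    (@Pi.topologicalSpace (OpenNormalSubgroup G)
      (fun N => WittRing G A ⧸ WittRing.K A N.toSubgroup) fun _ => ⊥)

/-- The initial vanishing topology: a set `O` is open when each `a` in `O` has a coset
`a + I_n` contained in `O`, for some positive `n`. -/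
@[reducible]
noncomputable def initialVanishingTopology : TopologicalSpace (WittRing G A) where
  IsOpen O := ∀ a ∈ O, ∃ n : ℕ, 1 ≤ n ∧ ∀ b ∈ WittRing.I G A n, a + b ∈ O
  isOpen_univ := fun _ _ => ⟨1, le_rfl, fun _ _ => trivial⟩
  isOpen_inter := by
    rintro O P hO hP a ⟨haO, haP⟩
    obtain ⟨n, hn, h⟩ := hO a haO
    obtain ⟨m, _, h'⟩ := hP a haP
    exact ⟨max n m, hn.trans (le_max_left _ _), fun b hb =>
      ⟨h b (WittRing.I_antitone (le_max_left n m) hb),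
        h' b (WittRing.I_antitone (le_max_right n m) hb)⟩⟩
  isOpen_sUnion := by
    rintro 𝒪 h a ⟨O, hO, ha⟩
    obtain ⟨n, hn, hb⟩ := h O hO a ha
    exact ⟨n, hn, fun b hbI => ⟨O, hO, hb b hbI⟩⟩

end WittRing

/-- A topological group is topologically finitely generated when some finite set generates a dense
subgroup. -/
def IsTopologicallyFG (G : Type*) [Group G] [TopologicalSpace G] : Prop :=
  ∃ S : Set G, S.Finite ∧ Dense (Subgroup.closure S : Set G)

end WittBurnside

/-! Both topologies are governed by cosets of ideals. A set is open in the initial vanishing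
topology when it contains a coset of some `I_n` around each of its points, while the profinite
topology is generated by the cosets of the `K_N`. The comparison therefore reduces to inclusions
between the two families of ideals, and these are statements about which finite transitive `G`-sets
are small and on which of them `N` acts trivially. From the ring structure only the fact that `I_n`
and `K_N` are ideals is needed.

If `N` acts trivially on `T`, then `T` is a quotient of `G ⧸ N`, so it has at most `[G : N]`
elements. Hence `I_n ⊆ K_N` for `n = [G : N] + 1` (`I_le_K`). This makes `K_N` open and gives one
inequality of topologies, for any `G`.

The reverse inequality needs, for each `n`, an open normal `N` with `K_N ⊆ I_n`, that is, one acting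
trivially on every `T` with fewer than `n` elements. Numbering the points of `T` turns the action
into a homomorphism from `G` to the permutations of `Fin n` with open kernel. Such a homomorphism is
determined by its values on a finite set generating a dense subgroup, so there are finitely many of
them (`IsTopologicallyFG.finite_monoidHom`), and the intersection of their kernels is the required
`N` (`IsTopologicallyFG.exists_openNormalSubgroup_forall_smul_eq`). -/

namespace WittBurnside

/-! ### Homomorphisms with open kernel and actions on small sets. -/

section OpenKernels

variable {G : Type*} [Group G] [TopologicalSpace G] [IsTopologicalGroup G]

/-- An open kernel is continuity for the discrete topology on `P`, so this is agreement on a dense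
subset. Stating it through kernels avoids putting a topology on `P`. -/
theorem monoidHom_eq_of_eqOn_dense {P : Type*} [Group P] {S : Set G}
    (hS : Dense (Subgroup.closure S : Set G)) {f g : G →* P} (hf : IsOpen (f.ker : Set G))
    (hg : IsOpen (g.ker : Set G)) (h : Set.EqOn f g S) : f = g := by
  -- On the intersection of the two open kernels both maps are trivial, hence equal.
  have hopen : IsOpen (f.eqLocus g : Set G) := by
    refine Subgroup.isOpen_mono (H₁ := f.ker ⊓ g.ker) ?_ (hf.inter hg)
    rintro x ⟨hx, hx'⟩
    exact (MonoidHom.mem_ker.1 hx).trans (MonoidHom.mem_ker.1 hx').symm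
  have hle : Subgroup.closure S ≤ f.eqLocus g := (Subgroup.closure_le _).2 h
  ext1 x
  -- An open subgroup is closed, so the equalizer contains the closure of a dense subgroup.
  exact (closure_minimal hle (Subgroup.isClosed_of_isOpen _ hopen)) (hS x)

/-- Restriction to the finite generating set `S` is injective on these homomorphisms, and there are
finitely many functions from `S` to `P`. -/
theorem IsTopologicallyFG.finite_monoidHom (hG : IsTopologicallyFG G) (P : Type*) [Group P]
    [Finite P] : {f : G →* P | IsOpen (f.ker : Set G)}.Finite := by
  obtain ⟨S, hS, hd⟩ := hG
  have := hS.to_subtype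
  refine Set.Finite.of_finite_image (f := fun f (s : S) => f s) (Set.toFinite _) ?_
  intro f hf g hg hfg
  exact monoidHom_eq_of_eqOn_dense hd hf hg fun s hs => congrFun hfg ⟨s, hs⟩

variable [CompactSpace G]

/-- An open subgroup of a compact group has finite index and is closed. Its normal core inherits
both properties, and a closed subgroup of finite index is open. -/
theorem isOpen_normalCore (H : OpenSubgroup G) : IsOpen (H.toSubgroup.normalCore : Set G) := by
  have : Finite (G ⧸ H.toSubgroup) := Frame.finite_quotient H
  have : H.toSubgroup.FiniteIndex := Subgroup.finiteIndex_of_finite_quotient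
  exact Subgroup.isOpen_of_isClosed_of_finiteIndex _
    (Subgroup.normalCore_isClosed _ H.isClosed)

/-- In a topologically finitely generated group, a single open normal subgroup acts trivially on
all transitive sets of bounded size. -/
theorem IsTopologicallyFG.exists_openNormalSubgroup_forall_smul_eq (hG : IsTopologicallyFG G)
    (n : ℕ) : ∃ N : OpenNormalSubgroup G, ∀ T : Frame G, T.size < n →
      ∀ g ∈ N.toSubgroup, ∀ x : T.Carrier, g • x = x := by
  have hfin := hG.finite_monoidHom (Equiv.Perm (Fin n))
  let Φ := {f : G →* Equiv.Perm (Fin n) | IsOpen (f.ker : Set G)}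
  have : Finite Φ := hfin.to_subtype
  -- The witness is the common kernel of all homomorphisms in `Φ`; finiteness of `Φ` is what keeps
  -- this intersection open.
  refine ⟨{ toSubgroup := ⨅ f : Φ, f.1.ker, isOpen' := ?_, isNormal' := ?_ }, ?_⟩
  · change IsOpen ((⨅ f : Φ, f.1.ker : Subgroup G) : Set G)
    rw [Subgroup.coe_iInf]
    exact isOpen_iInter_of_finite fun f => f.2
  · exact Subgroup.normal_iInf_normal fun f => inferInstance
  · intro T hT g hg x
    -- Embedding every `T` of size below `n` in the same `Fin n` lets one finite set `Φ` serve all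
    -- of them. Points of `Fin n` outside the image of `e` are left fixed.
    let e : T.Carrier ↪ Fin n :=
      (Finite.equivFin T.Carrier).toEmbedding.trans (Fin.castLEEmb hT.le)
    let f : G →* Equiv.Perm (Fin n) :=
      (Equiv.Perm.viaEmbeddingHom e).comp (MulAction.toPermHom G T.Carrier)
    have hker : f.ker = (MulAction.toPermHom G T.Carrier).ker :=
      MonoidHom.ker_comp_of_injective _ _ (Equiv.Perm.viaEmbeddingHom_injective e)
    have hf : f ∈ Φ := by
      change IsOpen (f.ker : Set G)
      -- The kernel of the action on `G ⧸ H` is the normal core of `H`.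
      rw [hker, ← Subgroup.normalCore_eq_ker]
      exact isOpen_normalCore T.rep
    have hgf : g ∈ f.ker := Subgroup.mem_iInf.1 hg ⟨f, hf⟩
    rw [hker, MonoidHom.mem_ker] at hgf
    exact congrArg (fun p : Equiv.Perm T.Carrier => p x) hgf

end OpenKernels

/-! ### Comparison of the ideals `I_n` and `K_N` and of the two topologies. -/

namespace WittRing

variable {G : Type*} [Group G] [TopologicalSpace G] [IsTopologicalGroup G] [CompactSpace G]
  (A : Type*) [CommRing A]

/-- If `N` acts trivially on `T`, it fixes the base point, so it lies in `T.rep` and `#T = [G :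
T.rep] ≤ [G : N]`. The `+ 1` turns this bound into the strict inequality in the definition of `I`.
-/
theorem I_le_K (N : OpenNormalSubgroup G) :
    I G A (Nat.card (G ⧸ N.toSubgroup) + 1) ≤ K A N.toSubgroup := by
  intro a ha T hT
  refine ha T (Nat.lt_succ_of_le ?_)
  have hle : N.toSubgroup ≤ T.rep.toSubgroup := fun g hg => T.smul_base_eq.1 (hT g hg T.base)
  have : Finite (G ⧸ N.toSubgroup) := Frame.finite_quotient N.toOpenSubgroup
  have : N.toSubgroup.FiniteIndex := Subgroup.finiteIndex_of_finite_quotient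
  exact Subgroup.index_antitone hle

/-- An additive subgroup containing some `I_n` with `n ≥ 1` contains the coset of `I_n` around each
of its elements. -/
theorem isOpen_K (N : OpenNormalSubgroup G) :
    @IsOpen _ (initialVanishingTopology G A) (K A N.toSubgroup : Set (WittRing G A)) :=
  fun _ ha => ⟨_, Nat.le_add_left 1 _, fun _ hb => add_mem ha (I_le_K A N hb)⟩

/-- In the order on topologies the finer one is the smaller, so this says that profinite-open sets
are open for initial vanishing. It amounts to continuity of each projection modulo `K_N`. -/
theorem initialVanishingTopology_le_profiniteTopology :
    initialVanishingTopology G A ≤ profiniteTopology G A := by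
  let _ := initialVanishingTopology G A
  let _ (N : OpenNormalSubgroup G) : TopologicalSpace (WittRing G A ⧸ K A N.toSubgroup) := ⊥
  -- Continuity is checked one factor at a time. The openness of `s` is discarded because the factor
  -- is discrete; what is left is to find a coset of `I_n` on which the class modulo `K_N` is
  -- constant.
  refine continuous_iff_le_induced.1 (continuous_pi fun N => ⟨fun s _ a ha => ?_⟩)
  refine ⟨Nat.card (G ⧸ N.toSubgroup) + 1, Nat.le_add_left 1 _, fun b hb => ?_⟩
  have h : Ideal.Quotient.mk (K A N.toSubgroup) (a + b) = Ideal.Quotient.mk _ a :=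
    Ideal.Quotient.eq.2 (by simpa using I_le_K A N hb)
  change Ideal.Quotient.mk (K A N.toSubgroup) (a + b) ∈ s
  rw [h]
  exact ha

/-- The coset of `a` is the preimage of a single point of the discrete factor at `N`. -/
theorem isOpen_profiniteTopology_coset (N : OpenNormalSubgroup G) (a : WittRing G A) :
    @IsOpen _ (profiniteTopology G A) {b | b - a ∈ K A N.toSubgroup} := by
  let _ (N : OpenNormalSubgroup G) : TopologicalSpace (WittRing G A ⧸ K A N.toSubgroup) := ⊥
  refine isOpen_induced_iff.2
    ⟨(fun q => q N) ⁻¹' {Ideal.Quotient.mk (K A N.toSubgroup) a}, ?_, ?_⟩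
  · exact (continuous_apply N).isOpen_preimage _ trivial
  · ext b
    exact Ideal.Quotient.eq

/-- Around a point `a` of `O`, the `N` supplied by finite generation satisfies `K_N ⊆ I_n`, so the
profinite-open coset `a + K_N` lies in `a + I_n`, hence in `O`. -/
theorem profiniteTopology_le_initialVanishingTopology (hG : IsTopologicallyFG G) :
    profiniteTopology G A ≤ initialVanishingTopology G A := by
  intro O hO
  refine (@isOpen_iff_forall_mem_open _ (profiniteTopology G A) O).2 fun a ha => ?_
  obtain ⟨n, _, hn⟩ := hO a ha
  obtain ⟨N, hN⟩ := hG.exists_openNormalSubgroup_forall_smul_eq n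
  refine ⟨{b | b - a ∈ K A N.toSubgroup}, fun b hb => ?_,
    isOpen_profiniteTopology_coset A N a, ?_⟩
  · rw [← add_sub_cancel a b]
    -- The inclusion `K_N ⊆ I_n`, applied to `b - a`: if `T` has fewer than `n` points, then `N`
    -- acts trivially on it and the coordinate at `T` vanishes.
    exact hn _ fun T hT => hb T (hN T hT)
  · change a - a ∈ K A N.toSubgroup
    rw [sub_self]
    exact zero_mem _

end WittRing

end WittBurnside

theorem mainTheorem9 (G : Type*) [Group G] [TopologicalSpace G] [IsTopologicalGroup G]
    [CompactSpace G] [T2Space G] [TotallyDisconnectedSpace G] (A : Type*) [CommRing A] :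
    (∀ N : OpenNormalSubgroup G,
      @IsOpen (WittBurnside.WittRing G A) (WittBurnside.initialVanishingTopology G A)
        (WittBurnside.WittRing.K A N.toSubgroup : Set (WittBurnside.WittRing G A))) ∧
    (WittBurnside.IsTopologicallyFG G →
      WittBurnside.profiniteTopology G A = WittBurnside.initialVanishingTopology G A) :=
  ⟨WittBurnside.WittRing.isOpen_K A, fun hG =>
    -- Finite generation enters only through this first inequality.
    le_antisymm (WittBurnside.WittRing.profiniteTopology_le_initialVanishingTopology A hG)
      (WittBurnside.WittRing.initialVanishingTopology_le_profiniteTopology A)⟩
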